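/- Let $\Omega\subset\mathbb{C}^n$ be a bounded convex domain (a nonempty connected open set) and let $\mathsf{k}_\Omega$ be its Kobayashi distance, normalized so that the Poincaré distance of the unit disc satisfies $\mathsf{k}_{\mathbb{D}}(0,\zeta)=\tfrac12\log\frac{1+|\zeta|}{1-|\zeta|}$. Let $C(\Omega)$ be the space of real-valued continuous functions on the metric space $(\Omega,\mathsf{k}_\Omega)$ with the topology of locally uniform convergence, $C_*(\Omega)$ its quotient by the constant functions with the quotient topology, and $i_{\mathsf{k}}:\Omega\to C_*(\Omega)$, $i_{\mathsf{k}}(z)=[\mathsf{k}_\Omega(z,\cdot)]$. The metric compactification $\overline{\Omega}^{\mathsf{k}}$ is the closure of $i_{\mathsf{k}}(\Omega)$ in $C_*(\Omega)$, and the metric boundary is $\partial\overline{\Omega}^{\mathsf{k}}=\overline{\Omega}^{\mathsf{k}}\setminus i_{\mathsf{k}}(\Omega)$. For $p\in\Omega$ and $\xi\in\partial\overline{\Omega}^{\mathsf{k}}$ let $h_{p,\xi}$ be the unique function with $[h_{p,\xi}]=\xi$ and $h_{p,\xi}(p)=0$, and for $R>0$ let $$H_p(\xi,R)=\{z\in\Omega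 : h_{p,\xi}(z)<\tfrac12\log R\}.$$ For $x\in\partial\Omega$ let $\mathscr{H}(x)$ be the set of all $\xi\in\partial\overline{\Omega}^{\mathsf{k}}$ for which there is a sequence $(x_k)$ in $\Omega$ with $x_k\to x$ in $\mathbb{C}^n$ and $i_{\mathsf{k}}(x_k)\to\xi$ in $\overline{\Omega}^{\mathsf{k}}$. Proposition. Let $\xi\in\partial\overline{\Omega}^{\mathsf{k}}$, let $x\in\partial\Omega$ be such that $\xi\in\mathscr{H}(x)$, and let $p\in\Omega$. Then $$h_{p,\xi}\big(tz_1+(1-t)z_2\big)\le\max\{h_{p,\xi}(z_1),h_{p,\xi}(z_2)\}\qquad\text{for all } z_1,z_2\in\Omega,\ t\in[0,1].$$ In particular, for every $R>0$ the horoball $H_p(\xi,R)$ is convex; moreover, $x$ belongs to the closure of $H_p(\xi,R)$ in $\mathbb{C}^n$. -/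

import Mathlib

open Set Filter Topology

/-! ### The metric compactification of a metric space -/

section MetricCompactification

/-- The subspace of constant functions of `C(X)`. -/
def constantFunctions (X : Type*) [TopologicalSpace X] : Submodule ℝ C(X, ℝ) where
  carrier := {f | ∃ c : ℝ, f = ContinuousMap.const X c}
  add_mem' := by
    rintro _ _ ⟨a, rfl⟩ ⟨b, rfl⟩
    exact ⟨a + b, rfl⟩
  zero_mem' := ⟨0, rfl⟩
  smul_mem' := by
    rintro c _ ⟨a, rfl⟩
    exact ⟨c * a, rfl⟩

/-- `C_*(X)`: continuous functions modulo constants, with the quotient of the compact-open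
topology (which is the topology of locally uniform convergence when `X` is locally compact). -/
abbrev FunctionsModConstants (X : Type*) [TopologicalSpace X] : Type _ :=
  C(X, ℝ) ⧸ constantFunctions X

/-- The normalization `T_p : C_*(X) → C(X)`, `[f] ↦ f - f(p)`. -/
def normalizeAt {X : Type*} [TopologicalSpace X] (p : X) :
    FunctionsModConstants X →ₗ[ℝ] C(X, ℝ) :=
  (constantFunctions X).liftQ
    { toFun := fun f => f - ContinuousMap.const X (f p)
      map_add' := by
        intro f g
        ext x
        simp only [ContinuousMap.sub_apply, ContinuousMap.add_apply, ContinuousMap.const_apply]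
        ring
      map_smul' := by
        intro c f
        ext x
        simp only [ContinuousMap.sub_apply, ContinuousMap.smul_apply, ContinuousMap.const_apply,
          smul_eq_mul, RingHom.id_apply]
        ring }
    (by
      rintro _ ⟨c, rfl⟩
      ext x
      simp)

variable {X : Type*} [PseudoMetricSpace X]

/-- The canonical map `i_d : X → C_*(X)`, `x ↦ [d(x, ·)]`. -/
def metricEmbedding (x : X) : FunctionsModConstants X :=
  (constantFunctions X).mkQ ⟨fun z => dist x z, continuous_const.dist continuous_id⟩

variable (X) in
/-- The metric compactification: the closure of `i_d(X)` in `C_*(X)`. -/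
def metricCompactification : Set (FunctionsModConstants X) :=
  closure (range (metricEmbedding (X := X)))

variable (X) in
/-- The metric boundary. -/
def metricBoundary : Set (FunctionsModConstants X) :=
  metricCompactification X \ range (metricEmbedding (X := X))

/-- `h_{p, ξ}`: the function representing `ξ` that vanishes at `p`. -/
def horofunction (p : X) (ξ : FunctionsModConstants X) : C(X, ℝ) :=
  normalizeAt p ξ

/-- `horofunction p ξ` is the one and only representative of `ξ` that vanishes at `p`. -/
theorem horofunction_spec (p : X) (ξ : FunctionsModConstants X) (h : C(X, ℝ)) :
    h = horofunction p ξ ↔ (constantFunctions X).mkQ h = ξ ∧ h p = 0 := by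
  obtain ⟨f, rfl⟩ := (constantFunctions X).mkQ_surjective ξ
  have key : horofunction p ((constantFunctions X).mkQ f) = f - ContinuousMap.const X (f p) :=
    rfl
  rw [key]
  constructor
  · rintro rfl
    refine ⟨?_, by simp⟩
    rw [Submodule.mkQ_apply, Submodule.mkQ_apply, Submodule.Quotient.eq]
    refine ⟨-(f p), ?_⟩
    ext x
    simp
  · rintro ⟨h1, h2⟩
    rw [Submodule.mkQ_apply, Submodule.mkQ_apply, Submodule.Quotient.eq] at h1
    obtain ⟨c, hc⟩ := h1
    have hx : ∀ x, h x - f x = c := fun x => by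
      simpa using congrArg (fun g : C(X, ℝ) => g x) hc
    ext x
    have h3 := hx x
    have h4 := hx p
    simp only [ContinuousMap.sub_apply, ContinuousMap.const_apply]
    linarith

/-- The horoball `H_p(ξ, R)`. -/
def horoball (p : X) (ξ : FunctionsModConstants X) (R : ℝ) : Set X :=
  {x | horofunction p ξ x < 1 / 2 * Real.log R}

end MetricCompactification

/-! ### The Kobayashi distance of a domain -/

/-- The Poincaré distance of the unit disc,
`artanh |(a - b) / (1 - conj a * b)| = 1/2 log ((1 + t) / (1 - t))`,
where `t = |(a - b) / (1 - conj a * b)|`. -/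
noncomputable def poincareDist (a b : ℂ) : ℝ :=
  Real.artanh ‖(a - b) / (1 - (starRingEnd ℂ) a * b)‖

/-- `DiscChain Ω z w ℓ`: there is a finite chain of holomorphic discs in `Ω` joining `z` to `w`
of total Poincaré length `ℓ`, i.e. holomorphic `φ₁, …, φₘ : 𝔻 → Ω` and `aⱼ, bⱼ ∈ 𝔻` with
`φ₁ a₁ = z`, `φⱼ bⱼ = φⱼ₊₁ aⱼ₊₁`, `φₘ bₘ = w` and `ℓ = ∑ⱼ poincareDist aⱼ bⱼ`. -/
inductive DiscChain {E : Type*} [NormedAddCommGroup E] [NormedSpace ℂ E] (Ω : Set E)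
    (z : E) : E → ℝ → Prop
  | refl (hz : z ∈ Ω) : DiscChain Ω z z 0
  | step {w : E} {ℓ : ℝ} (h : DiscChain Ω z w ℓ) (φ : ℂ → E)
      (hφ : DifferentiableOn ℂ φ (Metric.ball 0 1)) (hm : MapsTo φ (Metric.ball 0 1) Ω)
      (a b : ℂ) (ha : a ∈ Metric.ball (0 : ℂ) 1) (hb : b ∈ Metric.ball (0 : ℂ) 1)
      (haw : φ a = w) : DiscChain Ω z (φ b) (ℓ + poincareDist a b)

/-- The Kobayashi (pseudo)distance of `Ω`: the infimum of the lengths of the chains of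
holomorphic discs in `Ω` from `z` to `w`. -/
noncomputable def kobayashiDist {E : Type*} [NormedAddCommGroup E] [NormedSpace ℂ E]
    (Ω : Set E) (z w : E) : ℝ :=
  sInf {ℓ : ℝ | DiscChain Ω z w ℓ}

theorem poincareDist_nonneg (a b : ℂ) : 0 ≤ poincareDist a b :=
  Real.artanh_nonneg (norm_nonneg _)

theorem poincareDist_comm (a b : ℂ) : poincareDist a b = poincareDist b a := by
  unfold poincareDist
  congr 1
  rw [norm_div, norm_div, norm_sub_rev]
  congr 1
  rw [← Complex.norm_conj]
  congr 1
  simp [mul_comm]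

section Chains

variable {E : Type*} [NormedAddCommGroup E] [NormedSpace ℂ E] {Ω : Set E}

theorem DiscChain.nonneg {z w : E} {ℓ : ℝ} (h : DiscChain Ω z w ℓ) : 0 ≤ ℓ := by
  induction h with
  | refl hz => exact le_rfl
  | step h φ hφ hm a b ha hb haw ih => exact add_nonneg ih (poincareDist_nonneg a b)

theorem DiscChain.trans {x y z : E} {ℓ ℓ' : ℝ} (h : DiscChain Ω x y ℓ)
    (h' : DiscChain Ω y z ℓ') : DiscChain Ω x z (ℓ + ℓ') := by
  induction h' with
  | refl hz => simpa using h
  | step h2 φ hφ hm a b ha hb haw ih =>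
    rw [← add_assoc]
    exact ih.step φ hφ hm a b ha hb haw

theorem DiscChain.left_mem {z w : E} {ℓ : ℝ} (h : DiscChain Ω z w ℓ) : z ∈ Ω := by
  induction h with
  | refl hz => exact hz
  | step h φ hφ hm a b ha hb haw ih => exact ih

theorem DiscChain.symm {z w : E} {ℓ : ℝ} (h : DiscChain Ω z w ℓ) : DiscChain Ω w z ℓ := by
  induction h with
  | refl hz => exact .refl hz
  | @step w ℓ h φ hφ hm a b ha hb haw ih =>
    have h1 : DiscChain Ω (φ b) w (poincareDist a b) := by
      have := (DiscChain.refl (Ω := Ω) (hm hb)).step φ hφ hm b a hb ha rfl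
      rw [haw, zero_add, poincareDist_comm] at this
      exact this
    rw [add_comm]
    exact h1.trans ih

/-- In an open connected set any two points are joined by a chain of holomorphic discs. -/
theorem DiscChain.exists_of_isConnected (ho : IsOpen Ω) (hc : IsPreconnected Ω) {z w : E}
    (hz : z ∈ Ω) (hw : w ∈ Ω) : ∃ ℓ, DiscChain Ω z w ℓ := by
  refine hc.induction₂' (fun x y => ∃ ℓ, DiscChain Ω x y ℓ) ?_ ?_ hz hw
  · intro x hx
    obtain ⟨r, hr, hball⟩ := Metric.isOpen_iff.1 ho x hx
    have hnhds : Metric.ball x (r / 2) ∈ 𝓝[Ω] x :=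
      mem_nhdsWithin_of_mem_nhds (Metric.ball_mem_nhds x (half_pos hr))
    filter_upwards [hnhds] with y hy
    have hchain : DiscChain Ω x y
        (0 + poincareDist 0 (1 / 2)) := by
      have hm : MapsTo (fun ζ : ℂ => x + ζ • ((2 : ℂ) • (y - x))) (Metric.ball 0 1) Ω := by
        intro ζ hζ
        apply hball
        rw [mem_ball_zero_iff] at hζ
        rw [mem_ball_iff_norm] at hy ⊢
        have e : x + ζ • ((2 : ℂ) • (y - x)) - x = ζ • ((2 : ℂ) • (y - x)) := by abel
        rw [e, norm_smul, norm_smul]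
        have h2 : ‖(2 : ℂ)‖ = 2 := by simp
        rw [h2]
        nlinarith [norm_nonneg (y - x), norm_nonneg ζ]
      have hd : DifferentiableOn ℂ (fun ζ : ℂ => x + ζ • ((2 : ℂ) • (y - x)))
          (Metric.ball 0 1) := by fun_prop
      have := (DiscChain.refl (Ω := Ω) hx).step _ hd hm 0 (1 / 2) (by simp)
        (by rw [mem_ball_zero_iff]; norm_num) (by simp)
      have e : x + (1 / 2 : ℂ) • ((2 : ℂ) • (y - x)) = y := by
        rw [smul_smul]
        norm_num
      simpa only [e] using this
    exact ⟨⟨_, hchain⟩, ⟨_, hchain.symm⟩⟩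
  · rintro x y z hx hy hz ⟨ℓ, h⟩ ⟨ℓ', h'⟩
    exact ⟨_, h.trans h'⟩

end Chains

/-- A domain in `ℂⁿ`: a nonempty connected open subset. -/
structure ComplexDomain (n : ℕ) where
  carrier : Set (EuclideanSpace ℂ (Fin n))
  isOpen : IsOpen carrier
  isConnected : IsConnected carrier

namespace ComplexDomain

variable {n : ℕ}

instance : Coe (ComplexDomain n) (Set (EuclideanSpace ℂ (Fin n))) := ⟨ComplexDomain.carrier⟩

/-- The points of `Ω`, as a type that is metrized by the Kobayashi distance below (and does not
carry the Euclidean distance). -/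
def Points (Ω : ComplexDomain n) : Type := {z : EuclideanSpace ℂ (Fin n) // z ∈ Ω.carrier}

/-- The inclusion of `Ω` in `ℂⁿ`. -/
def Points.val {Ω : ComplexDomain n} (z : Ω.Points) : EuclideanSpace ℂ (Fin n) := Subtype.val z

/-- A point of `ℂⁿ` that lies in `Ω`, as a point of `Ω`. -/
def Points.mk {Ω : ComplexDomain n} (z : EuclideanSpace ℂ (Fin n)) (hz : z ∈ Ω.carrier) :
    Ω.Points := ⟨z, hz⟩

theorem Points.val_mem {Ω : ComplexDomain n} (z : Ω.Points) : z.val ∈ Ω.carrier :=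
  Subtype.property z

/-- `(Ω, k_Ω)`. For bounded `Ω` this is a metric space, inducing the Euclidean topology. -/
noncomputable instance (Ω : ComplexDomain n) : PseudoMetricSpace Ω.Points where
  dist z w := kobayashiDist Ω.carrier z.val w.val
  dist_self z :=
    le_antisymm (csInf_le ⟨0, fun _ h => DiscChain.nonneg h⟩ (DiscChain.refl z.val_mem))
      (Real.sInf_nonneg fun _ h => DiscChain.nonneg h)
  dist_comm z w := by
    unfold kobayashiDist
    congr 1
    ext ℓ
    exact ⟨DiscChain.symm, DiscChain.symm⟩
  dist_triangle x y z := by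
    have hne : ∀ u v : Ω.Points, {ℓ : ℝ | DiscChain Ω.carrier u.val v.val ℓ}.Nonempty :=
      fun u v => DiscChain.exists_of_isConnected Ω.isOpen Ω.isConnected.isPreconnected
        u.val_mem v.val_mem
    refine le_of_forall_pos_lt_add fun ε hε => ?_
    obtain ⟨a, ha, ha'⟩ := Real.lt_sInf_add_pos (hne x y) (half_pos hε)
    obtain ⟨b, hb, hb'⟩ := Real.lt_sInf_add_pos (hne y z) (half_pos hε)
    have h : sInf {ℓ : ℝ | DiscChain Ω.carrier x.val z.val ℓ} ≤ a + b :=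
      csInf_le ⟨0, fun _ h => DiscChain.nonneg h⟩ (DiscChain.trans ha hb)
    unfold kobayashiDist
    linarith

/-- `𝓗(x)`: the metric boundary points `ξ` of `(Ω, k_Ω)` for which some sequence `(xₙ)` in `Ω`
converges to `x` in `ℂⁿ` and satisfies `i(xₙ) → ξ` in the metric compactification. -/
def metricFiber (Ω : ComplexDomain n) (x : EuclideanSpace ℂ (Fin n)) :
    Set (FunctionsModConstants Ω.Points) :=
  {ξ | ξ ∈ metricBoundary Ω.Points ∧ ∃ u : ℕ → Ω.Points,
    Tendsto (fun k => (u k).val) atTop (𝓝 x) ∧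
    Tendsto (fun k => metricEmbedding (u k)) atTop (𝓝 ξ)}

end ComplexDomain

/-! ### Discs normalized by automorphisms -/

/-! Along a sequence `u k → x` defining `ξ`, the horofunction is the pointwise limit of `dist (u k)
z - dist (u k) p`. Quasiconvexity therefore follows from convexity of Kobayashi balls
(`kobayashiDist_combine_le_max`). For this, two chains of discs of equal length are cut at the same
lengths, and convex combinations of the matching discs again lie in `Ω` (`DiscChain.combine`).

For the closure statement, the horofunction is first shown to be unbounded below
(`exists_horofunction_lt`). Harnack's inequality for a supporting complex functional puts the
boundary at infinite distance (`tendsto_dist_atTop`). Points at distance at most `s` from `p` on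
almost shortest chains to `u k` hence have a Euclidean cluster point inside `Ω`, where the
horofunction is at most `1 - s`. Then, starting from a point `q` of the horoball, the segment from
`q` to `x` stays in it (`horofunction_segment_le`), because the ball about `u k` through `q`
contains the segment from `q` to `u k`. -/

theorem Complex.normSq_one_add_conj_mul_sub (a ζ : ℂ) :
    Complex.normSq (1 + (starRingEnd ℂ) a * ζ) - Complex.normSq (ζ + a)
      = (1 - Complex.normSq a) * (1 - Complex.normSq ζ) := by
  simp only [Complex.normSq_apply, Complex.add_re, Complex.add_im, Complex.mul_re, Complex.mul_im,
    Complex.conj_re, Complex.conj_im, Complex.one_re, Complex.one_im]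
  ring

/-- This makes the Möbius map `(ζ + a) / (1 + conj a * ζ)` a self-map of the disc and keeps its
denominator away from zero. -/
theorem Complex.norm_add_lt_norm_one_add_conj_mul {a ζ : ℂ} (ha : ‖a‖ < 1) (hζ : ‖ζ‖ < 1) :
    ‖ζ + a‖ < ‖1 + (starRingEnd ℂ) a * ζ‖ := by
  have h := Complex.normSq_one_add_conj_mul_sub a ζ
  simp only [Complex.normSq_eq_norm_sq] at h
  have h1 : 0 < (1 - ‖a‖ ^ 2) * (1 - ‖ζ‖ ^ 2) :=
    mul_pos (by nlinarith [norm_nonneg a]) (by nlinarith [norm_nonneg ζ])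
  exact lt_of_pow_lt_pow_left₀ 2 (norm_nonneg _) (by linarith)

theorem Complex.one_add_conj_mul_ne_zero {a ζ : ℂ} (ha : ‖a‖ < 1) (hζ : ‖ζ‖ < 1) :
    1 + (starRingEnd ℂ) a * ζ ≠ 0 :=
  norm_pos_iff.1 ((norm_nonneg _).trans_lt (Complex.norm_add_lt_norm_one_add_conj_mul ha hζ))

theorem norm_mobius_lt_one {a b : ℂ} (ha : ‖a‖ < 1) (hb : ‖b‖ < 1) :
    ‖(a - b) / (1 - (starRingEnd ℂ) a * b)‖ < 1 := by
  have h := Complex.norm_add_lt_norm_one_add_conj_mul (ζ := -b) ha (by simpa using hb)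
  rw [mul_neg, ← sub_eq_add_neg, neg_add_eq_sub] at h
  rw [norm_div, div_lt_one ((norm_nonneg _).trans_lt h)]
  exact h

/-- An automorphism of the disc moves `0` and the pseudohyperbolic distance of `a` and `b`
to `a` and `b`. -/
theorem exists_disc_automorphism {a b : ℂ} (ha : ‖a‖ < 1) (hb : ‖b‖ < 1) :
    ∃ M : ℂ → ℂ, DifferentiableOn ℂ M (Metric.ball 0 1) ∧
      MapsTo M (Metric.ball 0 1) (Metric.ball 0 1) ∧ M 0 = a ∧
      M (‖(a - b) / (1 - (starRingEnd ℂ) a * b)‖ : ℝ) = b := by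
  set r : ℝ := ‖(a - b) / (1 - (starRingEnd ℂ) a * b)‖ with hr
  set c : ℂ := (b - a) / (1 - (starRingEnd ℂ) a * b) with hc
  have hcr : ‖c‖ = r := by rw [hc, hr, norm_div, norm_div, norm_sub_rev]
  have hden : 1 - (starRingEnd ℂ) a * b ≠ 0 := by
    have := Complex.one_add_conj_mul_ne_zero (ζ := -b) ha (by simpa using hb)
    rwa [mul_neg, ← sub_eq_add_neg] at this
  have hc1 : ‖c‖ < 1 := hcr ▸ norm_mobius_lt_one ha hb
  -- A rotation carrying `r` to `c`. If `r = 0`, the choice `u = 0` makes `M` constant, which is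
  -- harmless since only a holomorphic self-map is needed.
  obtain ⟨u, hu, hcu⟩ : ∃ u : ℂ, ‖u‖ ≤ 1 ∧ u * r = c := by
    by_cases h0 : r = 0
    · refine ⟨0, by simp, ?_⟩
      have : c = 0 := norm_eq_zero.1 (hcr.trans h0)
      simp [this]
    · have h0' : (r : ℂ) ≠ 0 := by exact_mod_cast h0
      refine ⟨c / r, ?_, div_mul_cancel₀ _ h0'⟩
      rw [norm_div, hcr, Complex.norm_real, Real.norm_of_nonneg (norm_nonneg _), div_self h0]
  have hmem : ∀ ζ ∈ Metric.ball (0 : ℂ) 1, ‖u * ζ‖ < 1 := by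
    intro ζ hζ
    rw [mem_ball_zero_iff] at hζ
    rw [norm_mul]
    nlinarith [norm_nonneg ζ, norm_nonneg u]
  refine ⟨fun ζ => (u * ζ + a) / (1 + (starRingEnd ℂ) a * (u * ζ)), ?_, ?_, ?_, ?_⟩
  · refine DifferentiableOn.div (by fun_prop) (by fun_prop) fun ζ hζ => ?_
    exact Complex.one_add_conj_mul_ne_zero ha (hmem ζ hζ)
  · intro ζ hζ
    have h := Complex.norm_add_lt_norm_one_add_conj_mul ha (hmem ζ hζ)
    rw [mem_ball_zero_iff, norm_div, div_lt_one ((norm_nonneg _).trans_lt h)]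
    exact h
  · simp
  · simp only [hcu]
    rw [div_eq_iff (Complex.one_add_conj_mul_ne_zero ha hc1)]
    have := div_mul_cancel₀ (b - a) hden
    rw [← hc] at this
    linear_combination this

/-! ### Cutting chains of discs and combining them in convex sets -/

section Steps

variable {E : Type*} [NormedAddCommGroup E] [NormedSpace ℂ E] {Ω : Set E}

/-- `DiscStep Ω z w d`: a holomorphic disc in `Ω` sends `0` to `z` and the point `tanh d` at
Poincaré distance `d` from `0` to `w`. -/
def DiscStep (Ω : Set E) (z w : E) (d : ℝ) : Prop :=
  0 ≤ d ∧ ∃ φ : ℂ → E, DifferentiableOn ℂ φ (Metric.ball 0 1) ∧ MapsTo φ (Metric.ball 0 1) Ω ∧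
    φ 0 = z ∧ φ (Real.tanh d : ℝ) = w

theorem ofReal_tanh_mem_ball (d : ℝ) : ((Real.tanh d : ℝ) : ℂ) ∈ Metric.ball (0 : ℂ) 1 := by
  rw [mem_ball_zero_iff, Complex.norm_real]
  exact Real.abs_tanh_lt_one d

theorem Real.tanh_nonneg_of_nonneg {d : ℝ} (hd : 0 ≤ d) : 0 ≤ Real.tanh d := by
  rw [Real.tanh_eq_sinh_div_cosh]
  exact div_nonneg (Real.sinh_nonneg_iff.2 hd) (Real.cosh_pos d).le

/-- By the subtraction formula, `tanh` parametrizes the real diameter by arc length, so lengths add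
exactly when a disc is cut there. -/
theorem poincareDist_tanh {e d : ℝ} (h : e ≤ d) :
    poincareDist (Real.tanh e : ℝ) (Real.tanh d : ℝ) = d - e := by
  have key : Real.tanh (d - e)
      = (Real.tanh d - Real.tanh e) / (1 - Real.tanh e * Real.tanh d) := by
    have h1 := (Real.cosh_pos d).ne'
    have h2 := (Real.cosh_pos e).ne'
    have h3 := (Real.cosh_pos (d - e)).ne'
    have h4 : 1 - Real.tanh e * Real.tanh d = Real.cosh (d - e) / (Real.cosh d * Real.cosh e) := by
      rw [Real.tanh_eq_sinh_div_cosh, Real.tanh_eq_sinh_div_cosh, Real.cosh_sub]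
      field_simp
    have h5 : Real.tanh d - Real.tanh e = Real.sinh (d - e) / (Real.cosh d * Real.cosh e) := by
      rw [Real.tanh_eq_sinh_div_cosh, Real.tanh_eq_sinh_div_cosh, Real.sinh_sub]
      field_simp
    rw [h4, h5, Real.tanh_eq_sinh_div_cosh]
    field_simp
  have e1 : ((Real.tanh e : ℝ) - (Real.tanh d : ℝ) : ℂ) /
      (1 - (starRingEnd ℂ) (Real.tanh e : ℝ) * (Real.tanh d : ℝ))
        = ((-Real.tanh (d - e) : ℝ) : ℂ) := by
    rw [key, Complex.conj_ofReal, ← neg_div, neg_sub]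
    push_cast
    rfl
  rw [poincareDist, e1, Complex.norm_real, norm_neg,
    Real.norm_of_nonneg (Real.tanh_nonneg_of_nonneg (sub_nonneg.2 h)), Real.artanh_tanh]

theorem discStep_of_disc {φ : ℂ → E} (hφ : DifferentiableOn ℂ φ (Metric.ball 0 1))
    (hm : MapsTo φ (Metric.ball 0 1) Ω) {a b : ℂ} (ha : a ∈ Metric.ball (0 : ℂ) 1)
    (hb : b ∈ Metric.ball (0 : ℂ) 1) : DiscStep Ω (φ a) (φ b) (poincareDist a b) := by
  rw [mem_ball_zero_iff] at ha hb
  obtain ⟨M, hM, hMm, hM0, hMr⟩ := exists_disc_automorphism ha hb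
  refine ⟨poincareDist_nonneg a b, φ ∘ M, hφ.comp hM hMm, hm.comp hMm, ?_, ?_⟩
  · simp [hM0]
  · rw [poincareDist, Real.tanh_artanh
      ⟨by linarith [norm_nonneg ((a - b) / (1 - (starRingEnd ℂ) a * b))],
        norm_mobius_lt_one ha hb⟩, Function.comp_apply, hMr]

theorem DiscStep.chain {z w v : E} {ℓ d : ℝ} (h : DiscChain Ω z w ℓ) (hs : DiscStep Ω w v d) :
    DiscChain Ω z v (ℓ + d) := by
  obtain ⟨hd, φ, hφ, hm, h0, h1⟩ := hs
  have := h.step φ hφ hm 0 (Real.tanh d : ℝ) (by simp) (ofReal_tanh_mem_ball d) h0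
  have e := poincareDist_tanh hd
  rw [Real.tanh_zero, Complex.ofReal_zero, sub_zero] at e
  rwa [e, h1] at this

theorem DiscStep.cut {z w : E} {d e : ℝ} (h : DiscStep Ω z w d) (he : 0 ≤ e) (hed : e ≤ d) :
    ∃ m, DiscStep Ω z m e ∧ DiscStep Ω m w (d - e) := by
  obtain ⟨hd, φ, hφ, hm, h0, h1⟩ := h
  refine ⟨φ (Real.tanh e : ℝ), ⟨he, φ, hφ, hm, h0, rfl⟩, ?_⟩
  have := discStep_of_disc hφ hm (ofReal_tanh_mem_ball e) (ofReal_tanh_mem_ball d)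
  rwa [poincareDist_tanh hed, h1] at this

/-- Constant discs serve as padding: they lengthen a chain without moving its endpoint. -/
theorem DiscStep.const {z : E} (hz : z ∈ Ω) {d : ℝ} (hd : 0 ≤ d) : DiscStep Ω z z d :=
  ⟨hd, fun _ => z, differentiableOn_const z, fun _ _ => hz, rfl, rfl⟩

/-- Induction on chains of normalized discs. -/
theorem DiscChain.induction_step {z : E} {P : E → ℝ → Prop} (h0 : P z 0)
    (hs : ∀ {w v : E} {ℓ d : ℝ}, DiscChain Ω z w ℓ → P w ℓ → DiscStep Ω w v d → P v (ℓ + d))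
    {w : E} {ℓ : ℝ} (h : DiscChain Ω z w ℓ) : P w ℓ := by
  induction h with
  | refl hz => exact h0
  | step h φ hφ hm a b ha hb haw ih =>
    refine hs h ih ?_
    rw [← haw]
    exact discStep_of_disc hφ hm ha hb

theorem DiscChain.right_mem {z w : E} {ℓ : ℝ} (h : DiscChain Ω z w ℓ) : w ∈ Ω :=
  h.symm.left_mem

theorem DiscChain.map {Ω' : Set E} {f : E → E} (hf : Differentiable ℂ f)
    (hm : MapsTo f Ω Ω') {z w : E} {ℓ : ℝ} (h : DiscChain Ω z w ℓ) :
    DiscChain Ω' (f z) (f w) ℓ := by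
  induction h with
  | refl hz => exact .refl (hm hz)
  | step h φ hφ hφm a b ha hb haw ih =>
    exact ih.step (f ∘ φ) (hf.comp_differentiableOn hφ) (hm.comp hφm) a b ha hb (by simp [haw])

/-- A chain can be cut at any length. -/
theorem DiscChain.cut {z w : E} {ℓ : ℝ} (h : DiscChain Ω z w ℓ) :
    ∀ s, 0 ≤ s → s ≤ ℓ → ∃ m, DiscChain Ω z m s ∧ DiscChain Ω m w (ℓ - s) := by
  have hzΩ := h.left_mem
  refine h.induction_step
    (P := fun w ℓ => ∀ s, 0 ≤ s → s ≤ ℓ → ∃ m, DiscChain Ω z m s ∧ DiscChain Ω m w (ℓ - s)) ?_ ?_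
  · intro s hs hs'
    obtain rfl : s = 0 := le_antisymm hs' hs
    exact ⟨z, .refl hzΩ, by simpa using DiscChain.refl hzΩ⟩
  · intro w v ℓ d hc ih hst s hs hs'
    rcases le_total s ℓ with h1 | h1
    · obtain ⟨m, hm1, hm2⟩ := ih s hs h1
      refine ⟨m, hm1, ?_⟩
      rw [show ℓ + d - s = ℓ - s + d by ring]
      exact hst.chain hm2
    · obtain ⟨m, hm1, hm2⟩ := hst.cut (e := s - ℓ) (by linarith) (by linarith)
      have h2 := hm1.chain hc
      refine ⟨m, by simpa using h2, ?_⟩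
      have h3 := hm2.chain (DiscChain.refl h2.right_mem)
      rwa [show 0 + (d - (s - ℓ)) = ℓ + d - s by ring] at h3

/-- Normalization places both endpoints at the same parameter `tanh d`, so the pointwise convex
combination of the two discs does the job. -/
theorem DiscStep.combine (hΩ : Convex ℝ Ω) {t : ℝ} (ht : t ∈ Icc (0 : ℝ) 1) {z₁ z₂ w₁ w₂ : E}
    {d : ℝ} (h₁ : DiscStep Ω z₁ w₁ d) (h₂ : DiscStep Ω z₂ w₂ d) :
    DiscStep Ω (t • z₁ + (1 - t) • z₂) (t • w₁ + (1 - t) • w₂) d := by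
  obtain ⟨hd, φ, hφ, hφm, rfl, rfl⟩ := h₁
  obtain ⟨-, ψ, hψ, hψm, rfl, rfl⟩ := h₂
  exact ⟨hd, fun ζ => t • φ ζ + (1 - t) • ψ ζ, (hφ.const_smul t).add (hψ.const_smul (1 - t)),
    fun ζ hζ => hΩ (hφm hζ) (hψm hζ) ht.1 (sub_nonneg.2 ht.2) (add_sub_cancel t 1), rfl, rfl⟩

/-- In a convex set, chains of equal length can be combined. -/
theorem DiscChain.combine (hΩ : Convex ℝ Ω) {t : ℝ} (ht : t ∈ Icc (0 : ℝ) 1) {z₁ z₂ : E}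
    {w₁ w₂ : E} {ℓ : ℝ} (h₁ : DiscChain Ω z₁ w₁ ℓ) (h₂ : DiscChain Ω z₂ w₂ ℓ) :
    DiscChain Ω (t • z₁ + (1 - t) • z₂) (t • w₁ + (1 - t) • w₂) ℓ := by
  have hz₁ := h₁.left_mem
  have hz₂ := h₂.left_mem
  have hmem : ∀ {a b : E}, a ∈ Ω → b ∈ Ω → t • a + (1 - t) • b ∈ Ω := fun ha hb =>
    hΩ ha hb ht.1 (sub_nonneg.2 ht.2) (add_sub_cancel t 1)
  revert w₂
  refine h₁.induction_step (P := fun w₁ ℓ => ∀ {w₂}, DiscChain Ω z₂ w₂ ℓ →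
    DiscChain Ω (t • z₁ + (1 - t) • z₂) (t • w₁ + (1 - t) • w₂) ℓ) ?_ ?_
  -- The second chain may still contain steps of length zero; an affine map carries it over as it
  -- is.
  · intro w₂ h₂
    exact h₂.map (f := fun y => t • z₁ + (1 - t) • y)
      ((differentiable_id.const_smul (1 - t)).const_add _) fun y hy => hmem hz₁ hy
  · intro m₁ w₁ ℓ d hc ih hst w₂ h₂
    -- Inner induction on the second chain. The last step of the first chain is kept arbitrary so
    -- that it can be shortened.
    have key := h₂.induction_step (P := fun w₂ L => ∀ (w₁ : E) (d : ℝ), DiscStep Ω m₁ w₁ d →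
      ℓ + d = L → DiscChain Ω (t • z₁ + (1 - t) • z₂) (t • w₁ + (1 - t) • w₂) L) ?_ ?_
    · exact key w₁ d hst rfl
    · intro w₁ d hst hd
      have h := hst.chain hc
      rw [hd] at h
      exact h.map (f := fun y => t • y + (1 - t) • z₂)
        ((differentiable_id.const_smul t).add_const _) fun y hy => hmem hy hz₂
    · intro m₂ w₂ L d₂ hc₂ ih₂ hst₂ w₁ d hst hd
      -- The longer of the two last steps is cut so that the tails match. What precedes the tails is
      -- covered by the inner hypothesis if `d₂ ≤ d`, and by the outer one otherwise.
      rcases le_total d₂ d with hle | hle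
      · obtain ⟨m, hm1, hm2⟩ := hst.cut (e := d - d₂) (by linarith) (by linarith [hst₂.1])
        rw [sub_sub_cancel] at hm2
        exact (hm2.combine hΩ ht hst₂).chain (ih₂ m _ hm1 (by linarith))
      · obtain ⟨m, hm1, hm2⟩ := hst₂.cut (e := d₂ - d) (by linarith) (by linarith [hst.1])
        rw [sub_sub_cancel] at hm2
        have h := hm1.chain hc₂
        rw [show L + (d₂ - d) = ℓ by linarith] at h
        rw [← hd]
        exact (hst.combine hΩ ht hm2).chain (ih h)

/-- Balls of the Kobayashi distance of a convex set are convex. -/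
theorem kobayashiDist_combine_le_max (ho : IsOpen Ω) (hΩ : Convex ℝ Ω) {t : ℝ}
    (ht : t ∈ Icc (0 : ℝ) 1) {z₁ z₂ w : E} (h₁ : z₁ ∈ Ω) (h₂ : z₂ ∈ Ω) (hw : w ∈ Ω) :
    kobayashiDist Ω (t • z₁ + (1 - t) • z₂) w
      ≤ max (kobayashiDist Ω z₁ w) (kobayashiDist Ω z₂ w) := by
  refine le_of_forall_pos_lt_add fun ε hε => ?_
  obtain ⟨a, ha, ha'⟩ := Real.lt_sInf_add_pos
    (DiscChain.exists_of_isConnected ho hΩ.isPreconnected h₁ hw) hε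
  obtain ⟨b, hb, hb'⟩ := Real.lt_sInf_add_pos
    (DiscChain.exists_of_isConnected ho hΩ.isPreconnected h₂ hw) hε
  -- A constant disc at `w` pads both chains to a common length.
  have hext : ∀ {z : E} {ℓ : ℝ}, DiscChain Ω z w ℓ → ℓ ≤ max a b → DiscChain Ω z w (max a b) := by
    intro z ℓ h hle
    simpa using (DiscStep.const hw (sub_nonneg.2 hle)).chain h
  have h := (hext ha (le_max_left a b)).combine hΩ ht (hext hb (le_max_right a b))
  rw [← add_smul, add_sub_cancel, one_smul] at h
  refine (csInf_le ⟨0, fun _ h => DiscChain.nonneg h⟩ h).trans_lt ?_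
  rw [← max_add_add_right]
  exact max_lt_max ha' hb'

/-! ### Upper and lower bounds for lengths of chains -/

theorem kobayashiDist_le_artanh {z w : E} {r : ℝ} (hr : Metric.ball z r ⊆ Ω)
    (hw : dist w z < r) : kobayashiDist Ω z w ≤ Real.artanh (dist w z / r) := by
  have hr0 : 0 < r := dist_nonneg.trans_lt hw
  set s := dist w z / r with hs
  have hs0 : 0 ≤ s := by positivity
  have hs1 : s < 1 := (div_lt_one hr0).2 hw
  have hsr : s * r = ‖w - z‖ := by rw [hs, ← dist_eq_norm, div_mul_cancel₀ _ hr0.ne']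
  have hst : DiscStep Ω z w (Real.artanh s) := by
    -- The affine disc of radius `r` through `w`. If `w = z`, then `ζ / s = 0` by convention and the
    -- disc is constant.
    refine ⟨Real.artanh_nonneg hs0, fun ζ => z + (ζ / s) • (w - z), by fun_prop, ?_, by simp, ?_⟩
    · intro ζ hζ
      rw [mem_ball_zero_iff] at hζ
      apply hr
      rw [mem_ball_iff_norm, add_sub_cancel_left, norm_smul, norm_div, Complex.norm_real,
        Real.norm_of_nonneg hs0, ← hsr]
      rcases hs0.eq_or_lt with h0 | h0
      · simpa [← h0] using hr0
      · rw [show ‖ζ‖ / s * (s * r) = ‖ζ‖ * r by field_simp]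
        nlinarith
    · rw [Real.tanh_artanh ⟨by linarith, hs1⟩]
      rcases hs0.eq_or_lt with h0 | h0
      · have : w - z = 0 := norm_eq_zero.1 (by rw [← hsr, ← h0, zero_mul])
        simp [(sub_eq_zero.1 this).symm]
      · have h1 : (s : ℂ) ≠ 0 := by exact_mod_cast h0.ne'
        simp [h1]
  have h := hst.chain (DiscChain.refl (hr (Metric.mem_ball_self hr0)))
  rw [zero_add] at h
  exact csInf_le ⟨0, fun _ h => DiscChain.nonneg h⟩ h

/-- Harnack's inequality for real parts of holomorphic functions on the disc. -/
theorem harnack_re {G : ℂ → ℂ} (hG : DifferentiableOn ℂ G (Metric.ball 0 1))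
    (hpos : ∀ ζ ∈ Metric.ball (0 : ℂ) 1, 0 < (G ζ).re) {ζ : ℂ} (hζ : ζ ∈ Metric.ball (0 : ℂ) 1) :
    (G 0).re * (1 - ‖ζ‖) ≤ (G ζ).re * (1 + ‖ζ‖) := by
  have h0 := hpos 0 (by simp)
  have hne : ∀ ζ ∈ Metric.ball (0 : ℂ) 1, G ζ + (starRingEnd ℂ) (G 0) ≠ 0 := by
    intro ζ hζ h
    have := congrArg Complex.re h
    simp only [Complex.add_re, Complex.conj_re, Complex.zero_re] at this
    linarith [hpos ζ hζ]
  -- Schwarz's lemma for `G` followed by the Cayley transform of the right half-plane that sends `G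
  -- 0` to `0`.
  have hS := Complex.norm_le_norm_of_mapsTo_ball (R := 1) (z := ζ)
    (f := fun ζ => (G ζ - G 0) / (G ζ + (starRingEnd ℂ) (G 0)))
    ((hG.sub_const _).div (hG.add_const _) hne) ?_ (by simp) (by simpa using hζ)
  · rw [norm_div, div_le_iff₀ (norm_pos_iff.2 (hne ζ hζ))] at hS
    have hr : ‖ζ‖ < 1 := by simpa using hζ
    have hr0 := norm_nonneg ζ
    have h1 := hpos ζ hζ
    have hsq := pow_le_pow_left₀ (norm_nonneg _) hS 2
    rw [mul_pow, ← Complex.normSq_eq_norm_sq (_ - _), ← Complex.normSq_eq_norm_sq (_ + _)] at hsq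
    simp only [Complex.normSq_apply, Complex.sub_re, Complex.sub_im, Complex.add_re,
      Complex.add_im, Complex.conj_re, Complex.conj_im] at hsq
    -- Both sides of `hsq` carry the same squared difference of imaginary parts, with weights `1`
    -- and `‖ζ‖ ^ 2`, so it can be dropped.
    have hsq' : ((G 0).re - (G ζ).re) ^ 2 ≤ (‖ζ‖ * ((G ζ).re + (G 0).re)) ^ 2 := by
      have h2 : 0 ≤ (1 - ‖ζ‖ ^ 2) * ((G ζ).im - (G 0).im) ^ 2 :=
        mul_nonneg (by nlinarith) (sq_nonneg _)
      nlinarith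
    have := abs_le_of_sq_le_sq' hsq' (by positivity)
    linarith [this.2]
  · intro ξ hξ
    rw [mem_closedBall_zero_iff, norm_div, div_le_one (norm_pos_iff.2 (hne ξ hξ))]
    refine le_of_sq_le_sq ?_ (norm_nonneg _)
    rw [← Complex.normSq_eq_norm_sq, ← Complex.normSq_eq_norm_sq]
    simp only [Complex.normSq_apply, Complex.sub_re, Complex.sub_im, Complex.add_re,
      Complex.add_im, Complex.conj_re, Complex.conj_im]
    nlinarith [mul_pos h0 (hpos ξ hξ)]

theorem Real.exp_two_mul_mul_one_sub_tanh (d : ℝ) :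
    Real.exp (2 * d) * (1 - Real.tanh d) = 1 + Real.tanh d := by
  rw [Real.tanh_eq, two_mul, Real.exp_add, Real.exp_neg]
  have := Real.exp_pos d
  field_simp
  ring

/-- The Harnack constant of a step of length `d` is `exp (2 * d)`, and these constants multiply
along a chain. Chains approaching the zeros of `(g ·).re` must therefore be long. -/
theorem DiscChain.re_le_re_mul_exp {g : E → ℂ} (hg : Differentiable ℂ g)
    (hpos : ∀ z ∈ Ω, 0 < (g z).re) {z w : E} {ℓ : ℝ} (h : DiscChain Ω z w ℓ) :
    (g z).re ≤ (g w).re * Real.exp (2 * ℓ) := by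
  refine h.induction_step (P := fun w ℓ => (g z).re ≤ (g w).re * Real.exp (2 * ℓ)) (by simp) ?_
  rintro w v ℓ d - ih ⟨hd, φ, hφ, hm, rfl, rfl⟩
  have hH := harnack_re (hg.comp_differentiableOn hφ) (fun ζ hζ => hpos _ (hm hζ))
    (ofReal_tanh_mem_ball d)
  rw [Complex.norm_real, Real.norm_of_nonneg (Real.tanh_nonneg_of_nonneg hd),
    ← Real.exp_two_mul_mul_one_sub_tanh, ← mul_assoc] at hH
  have hH' := le_of_mul_le_mul_right hH (sub_pos.2 (Real.tanh_lt_one d))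
  rw [mul_add, Real.exp_add, mul_comm (Real.exp _), ← mul_assoc]
  exact ih.trans (mul_le_mul_of_nonneg_right hH' (Real.exp_pos _).le)

end Steps

/-! ### Horofunctions as limits -/

section Horofunction

variable {X : Type*} [PseudoMetricSpace X]

/-- The difference of the evaluations at `z` and `p` kills constants, so it descends continuously to
the quotient. -/
theorem continuous_horofunction_apply (p z : X) : Continuous fun ξ => horofunction p ξ z := by
  refine (Submodule.isQuotientMap_mkQ (constantFunctions X)).continuous_iff.2 ?_
  change Continuous fun f : C(X, ℝ) => f z - f p
  fun_prop

theorem tendsto_dist_sub_dist_horofunction {u : ℕ → X} {ξ : FunctionsModConstants X}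
    (hu : Tendsto (fun k => metricEmbedding (u k)) atTop (𝓝 ξ)) (p z : X) :
    Tendsto (fun k => dist (u k) z - dist (u k) p) atTop (𝓝 (horofunction p ξ z)) :=
  ((continuous_horofunction_apply p z).tendsto ξ).comp hu

end Horofunction

/-! ### The Kobayashi distance of a bounded convex domain -/

namespace ComplexDomain

variable {n : ℕ} {Ω : ComplexDomain n}

theorem nonempty_discChain (z w : Ω.Points) :
    {ℓ : ℝ | DiscChain Ω.carrier z.val w.val ℓ}.Nonempty :=
  DiscChain.exists_of_isConnected Ω.isOpen Ω.isConnected.isPreconnected z.val_mem w.val_mem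

theorem exists_discChain_lt {z w : Ω.Points} {C : ℝ} (h : dist z w < C) :
    ∃ ℓ < C, DiscChain Ω.carrier z.val w.val ℓ := by
  obtain ⟨ℓ, hℓ, hℓC⟩ := exists_lt_of_csInf_lt (nonempty_discChain z w) h
  exact ⟨ℓ, hℓC, hℓ⟩

theorem dist_le_of_discChain {z w : Ω.Points} {ℓ : ℝ}
    (h : DiscChain Ω.carrier z.val w.val ℓ) : dist z w ≤ ℓ :=
  csInf_le ⟨0, fun _ h => DiscChain.nonneg h⟩ h

/-- The Euclidean topology is finer than the topology of the Kobayashi distance. -/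
theorem tendsto_of_tendsto_val {u : ℕ → Ω.Points} {y : Ω.Points}
    (h : Tendsto (fun k => (u k).val) atTop (𝓝 y.val)) : Tendsto u atTop (𝓝 y) := by
  obtain ⟨r, hr, hball⟩ := Metric.isOpen_iff.1 Ω.isOpen _ y.val_mem
  have hd := tendsto_iff_dist_tendsto_zero.1 h
  rw [tendsto_iff_dist_tendsto_zero]
  have hart : Tendsto (fun k => Real.artanh (dist (u k).val y.val / r)) atTop (𝓝 0) := by
    have hc : ContinuousAt Real.artanh 0 := by
      unfold Real.artanh
      refine ContinuousAt.log (ContinuousAt.sqrt ?_) (by simp)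
      exact ContinuousAt.div (by fun_prop) (by fun_prop) (by simp)
    have h0 : Tendsto (fun k => dist (u k).val y.val / r) atTop (𝓝 0) := by
      simpa using hd.div_const r
    simpa [Function.comp_def] using hc.tendsto.comp h0
  refine squeeze_zero' (.of_forall fun _ => dist_nonneg) ?_ hart
  filter_upwards [hd.eventually_lt_const hr] with k hk
  rw [dist_comm]
  exact kobayashiDist_le_artanh hball hk

/-- A convex domain is complete: its boundary is at infinite distance. -/
theorem tendsto_dist_atTop (hconv : Convex ℝ Ω.carrier) {x : EuclideanSpace ℂ (Fin n)}
    (hx : x ∉ Ω.carrier) {u : ℕ → Ω.Points} (hu : Tendsto (fun k => (u k).val) atTop (𝓝 x))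
    (p : Ω.Points) : Tendsto (fun k => dist p (u k)) atTop atTop := by
  -- The function `f x - f` has positive real part on `Ω` and vanishes at `x`.
  obtain ⟨f, hf⟩ := RCLike.geometric_hahn_banach_open_point (𝕜 := ℂ) hconv Ω.isOpen hx
  have hpos : ∀ z ∈ Ω.carrier, 0 < (f x - f z).re := fun z hz => by
    simpa using hf z hz
  have hg : Differentiable ℂ fun z => f x - f z := f.differentiable.const_sub _
  refine tendsto_atTop.2 fun C => ?_
  have hlim : Tendsto (fun k => (f x - f (u k).val).re * Real.exp (2 * C)) atTop (𝓝 0) := by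
    have : Continuous fun z => (f x - f z).re * Real.exp (2 * C) := by fun_prop
    simpa [Function.comp_def] using (this.tendsto x).comp hu
  filter_upwards [hlim.eventually_lt_const (hpos _ p.val_mem)] with k hk
  by_contra! hC
  obtain ⟨ℓ, hℓC, hℓ⟩ := exists_discChain_lt hC
  have h1 := hℓ.re_le_re_mul_exp hg hpos
  have h2 : Real.exp (2 * ℓ) ≤ Real.exp (2 * C) := Real.exp_le_exp.2 (by linarith)
  linarith [mul_le_mul_of_nonneg_left h2 (hpos _ (u k).val_mem).le]

theorem dist_combine_le_max (hconv : Convex ℝ Ω.carrier) {t : ℝ} (ht : t ∈ Icc (0 : ℝ) 1)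
    (z₁ z₂ w : Ω.Points) (h : t • z₁.val + (1 - t) • z₂.val ∈ Ω.carrier) :
    dist w (Points.mk _ h) ≤ max (dist w z₁) (dist w z₂) := by
  rw [dist_comm w, dist_comm w, dist_comm w]
  exact kobayashiDist_combine_le_max Ω.isOpen hconv ht z₁.val_mem z₂.val_mem w.val_mem

/-- A point at distance at most `s` from `p` that lies almost on a geodesic to `w`. -/
theorem exists_dist_le_dist_le {p w : Ω.Points} {s : ℝ} (hs : 0 ≤ s) (h : s ≤ dist p w) :
    ∃ q : Ω.Points, dist p q ≤ s ∧ dist w q - dist w p ≤ 1 - s := by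
  -- The slack `1` in the length of the chain is the `1` in the bound `1 - s`.
  obtain ⟨ℓ, hℓ1, hℓ⟩ := exists_discChain_lt (lt_add_one (dist p w))
  obtain ⟨m, hm1, hm2⟩ := hℓ.cut s hs (h.trans (dist_le_of_discChain hℓ))
  refine ⟨Points.mk m hm1.right_mem, dist_le_of_discChain hm1, ?_⟩
  have := dist_le_of_discChain (z := Points.mk m hm1.right_mem) (w := w) hm2
  rw [dist_comm w, dist_comm w]
  linarith

/-! ### Horofunctions of a bounded convex domain -/

/-- The horofunction of a boundary point is not bounded below. -/
theorem exists_horofunction_lt (hbdd : Bornology.IsBounded Ω.carrier)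
    (hconv : Convex ℝ Ω.carrier) {ξ : FunctionsModConstants Ω.Points}
    {x : EuclideanSpace ℂ (Fin n)} (hx : x ∉ Ω.carrier) {u : ℕ → Ω.Points}
    (hu : Tendsto (fun k => (u k).val) atTop (𝓝 x))
    (huξ : Tendsto (fun k => metricEmbedding (u k)) atTop (𝓝 ξ)) (p : Ω.Points) (c : ℝ) :
    ∃ q, horofunction p ξ q < c := by
  set s : ℝ := max 0 (2 - c) with hs
  have hs0 : 0 ≤ s := le_max_left _ _
  have hsc : 1 - s < c := by linarith [le_max_right 0 (2 - c)]
  have hev := (tendsto_dist_atTop hconv hx hu p).eventually_ge_atTop s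
  have hex : ∀ k, ∃ q : Ω.Points, s ≤ dist p (u k) →
      dist p q ≤ s ∧ dist (u k) q - dist (u k) p ≤ 1 - s := by
    intro k
    by_cases h : s ≤ dist p (u k)
    · obtain ⟨q, hq⟩ := exists_dist_le_dist_le hs0 h
      exact ⟨q, fun _ => hq⟩
    · exact ⟨p, fun h' => absurd h' h⟩
  choose q hq using hex
  -- Compactness is Euclidean. The limit `y` cannot lie outside `Ω`, since the points `q k`
  -- eventually stay within distance `s` of `p`.
  obtain ⟨y, -, φ, hφ, hy⟩ := tendsto_subseq_of_bounded hbdd fun k => (q k).val_mem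
  have hyΩ : y ∈ Ω.carrier := by
    by_contra hyΩ
    have h1 := tendsto_dist_atTop hconv hyΩ (u := q ∘ φ) hy p
    obtain ⟨k, hk1, hk2⟩ :=
      ((h1.eventually_gt_atTop s).and (hφ.tendsto_atTop.eventually hev)).exists
    exact absurd (hq _ hk2).1 (not_le.2 hk1)
  refine ⟨Points.mk y hyΩ, lt_of_le_of_lt ?_ hsc⟩
  have hqy : Tendsto (q ∘ φ) atTop (𝓝 (Points.mk y hyΩ)) := tendsto_of_tendsto_val hy
  have h1 := ((tendsto_dist_sub_dist_horofunction huξ p (Points.mk y hyΩ)).comp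
    hφ.tendsto_atTop).sub (tendsto_iff_dist_tendsto_zero.1 hqy)
  rw [sub_zero] at h1
  refine le_of_tendsto h1 ?_
  filter_upwards [hφ.tendsto_atTop.eventually hev] with k hk
  have h2 := (hq _ hk).2
  have h3 := dist_triangle (u (φ k)) (q (φ k)) (Points.mk y hyΩ)
  simp only [Function.comp_apply]
  linarith

theorem horofunction_combine_le_max (hconv : Convex ℝ Ω.carrier)
    {ξ : FunctionsModConstants Ω.Points} {u : ℕ → Ω.Points}
    (huξ : Tendsto (fun k => metricEmbedding (u k)) atTop (𝓝 ξ)) (p : Ω.Points)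
    {t : ℝ} (ht : t ∈ Icc (0 : ℝ) 1) (z₁ z₂ : Ω.Points)
    (h : t • z₁.val + (1 - t) • z₂.val ∈ Ω.carrier) :
    horofunction p ξ (Points.mk _ h) ≤ max (horofunction p ξ z₁) (horofunction p ξ z₂) := by
  refine le_of_tendsto_of_tendsto' (tendsto_dist_sub_dist_horofunction huξ p _)
    ((tendsto_dist_sub_dist_horofunction huξ p z₁).max
      (tendsto_dist_sub_dist_horofunction huξ p z₂)) fun k => ?_
  rw [max_sub_sub_right]
  exact sub_le_sub_right (dist_combine_le_max hconv ht z₁ z₂ (u k) h) _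

/-- Horofunctions do not increase on the segment towards the boundary point. -/
theorem horofunction_segment_le (hconv : Convex ℝ Ω.carrier)
    {ξ : FunctionsModConstants Ω.Points} {x : EuclideanSpace ℂ (Fin n)} {u : ℕ → Ω.Points}
    (hu : Tendsto (fun k => (u k).val) atTop (𝓝 x))
    (huξ : Tendsto (fun k => metricEmbedding (u k)) atTop (𝓝 ξ)) (p q : Ω.Points)
    {t : ℝ} (ht : t ∈ Icc (0 : ℝ) 1) (h : t • q.val + (1 - t) • x ∈ Ω.carrier) :
    horofunction p ξ (Points.mk _ h) ≤ horofunction p ξ q := by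
  have hmem : ∀ k, t • q.val + (1 - t) • (u k).val ∈ Ω.carrier := fun k =>
    hconv q.val_mem (u k).val_mem ht.1 (sub_nonneg.2 ht.2) (add_sub_cancel t 1)
  set y := Points.mk _ h
  have hv : Tendsto (fun k => Points.mk _ (hmem k)) atTop (𝓝 y) :=
    tendsto_of_tendsto_val ((hu.const_smul (1 - t)).const_add _)
  have h1 := (tendsto_dist_sub_dist_horofunction huξ p y).sub
    (tendsto_iff_dist_tendsto_zero.1 hv)
  rw [sub_zero] at h1
  refine le_of_tendsto_of_tendsto' h1 (tendsto_dist_sub_dist_horofunction huξ p q) fun k => ?_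
  -- The ball is centred at the endpoint `u k` itself, so the maximum is the distance to `q`.
  have h2 := dist_combine_le_max hconv ht q (u k) (u k) (hmem k)
  rw [dist_self, max_eq_left dist_nonneg] at h2
  have h3 := dist_triangle (u k) (Points.mk _ (hmem k)) y
  linarith

end ComplexDomain

theorem mainTheorem12 (n : ℕ) (Ω : ComplexDomain n)
    (hbdd : Bornology.IsBounded (Ω : Set (EuclideanSpace ℂ (Fin n))))
    (hconv : Convex ℝ (Ω : Set (EuclideanSpace ℂ (Fin n))))
    (ξ : FunctionsModConstants Ω.Points) (hξ : ξ ∈ metricBoundary Ω.Points)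
    (x : EuclideanSpace ℂ (Fin n)) (hx : x ∈ frontier (Ω : Set (EuclideanSpace ℂ (Fin n))))
    (hξx : ξ ∈ Ω.metricFiber x) (p : Ω.Points) :
    (∀ (z₁ z₂ : Ω.Points) (t : ℝ) (ht : t ∈ Set.Icc (0 : ℝ) 1),
      horofunction p ξ (ComplexDomain.Points.mk (t • z₁.val + (1 - t) • z₂.val)
          (hconv z₁.val_mem z₂.val_mem ht.1 (sub_nonneg.2 ht.2) (add_sub_cancel t 1)))
        ≤ max (horofunction p ξ z₁) (horofunction p ξ z₂)) ∧
    (∀ R : ℝ, 0 < R →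
      Convex ℝ (ComplexDomain.Points.val '' horoball p ξ R) ∧
      x ∈ closure (ComplexDomain.Points.val '' horoball p ξ R)) := by
  obtain ⟨-, u, hu, huξ⟩ := hξx
  have hxΩ : x ∉ Ω.carrier := by
    have := hx.2
    rwa [Ω.isOpen.interior_eq] at this
  refine ⟨fun z₁ z₂ t ht =>
    ComplexDomain.horofunction_combine_le_max hconv huξ p ht z₁ z₂ _, fun R _ => ⟨?_, ?_⟩⟩
  · rintro _ ⟨z₁, hz₁, rfl⟩ _ ⟨z₂, hz₂, rfl⟩ a b ha hb hab
    obtain rfl : b = 1 - a := by linarith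
    have hmem := hconv z₁.val_mem z₂.val_mem ha hb hab
    exact ⟨ComplexDomain.Points.mk _ hmem, (ComplexDomain.horofunction_combine_le_max hconv huξ p
      ⟨ha, by linarith⟩ z₁ z₂ hmem).trans_lt (max_lt hz₁ hz₂), rfl⟩
  · obtain ⟨q, hq⟩ :=
      ComplexDomain.exists_horofunction_lt hbdd hconv hxΩ hu huξ p (1 / 2 * Real.log R)
    have hlim : Tendsto (fun t : ℝ => t • q.val + (1 - t) • x) (𝓝[>] 0) (𝓝 x) := by
      have hc : Continuous fun t : ℝ => t • q.val + (1 - t) • x := by fun_prop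
      simpa using (hc.tendsto 0).mono_left nhdsWithin_le_nhds
    refine mem_closure_of_tendsto hlim ?_
    filter_upwards [Ioo_mem_nhdsGT (zero_lt_one' ℝ)] with t ht
    -- A segment from an interior point of a convex set to a point of its closure stays in the
    -- interior, except possibly at the latter endpoint.
    have hmem : t • q.val + (1 - t) • x ∈ Ω.carrier := by
      have := hconv.combo_interior_closure_mem_interior
        (x := q.val) (by rw [Ω.isOpen.interior_eq]; exact q.val_mem) hx.1 ht.1
        (sub_nonneg.2 ht.2.le) (add_sub_cancel t 1)
      exact interior_subset this
    exact ⟨ComplexDomain.Points.mk _ hmem, (ComplexDomain.horofunction_segment_le hconv hu huξ p q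
      ⟨ht.1.le, ht.2.le⟩ hmem).trans_lt hq, rfl⟩
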